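/- Let $K$ be a number field with ring of integers $O_K$. Let $\pi:\mathcal X\to\operatorname{Spec}O_K$ be an integral scheme, proper and flat over $O_K$, whose generic fibre $X_K$ is smooth of relative dimension one over $K$. Let $H$ be a line bundle and $E$ a vector bundle of rank $m$ on $\mathcal X$, and let $P_1,\dots,P_s:\operatorname{Spec}O_K\to\mathcal X$ be sections of $\pi$ with pairwise disjoint images; write $p_j\in X_K(K)$ for the generic point of $P_j$. For every $j$ we suppose given an isomorphism of $\operatorname{Spf}O_K[\![Z]\!]$ with the completion of $\mathcal X$ along $P_j$, and trivializations of $E$ and $H$ over this completion. By means of them a formal section $f_j\in H^0(\widehat X_{p_j};E_K^\vee)$ over the completion of $X_K$ at $p_j$ is an $m$-tuple of power series $\sum_{\ell\ge 0}a_\ell(k)Z^\ell\in K[\![Z]\!]$, $1\le k\le m$. *LG-germs.* Absolute values $\|\cdot\|_v$ at finite places are the normalized ones, $\|a\|_v=\#(O_K/\mathfrak p_v)^{-v(a)}$. The section $f_j$ is an LG-germ of type $\alpha$ if (a) for every place $v$ of $K$ and every $k$ the series $\sum_\ell a_\ell(k)Z^\ell$ has positive radius of convergence at $v$; (b) there are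 a finite set $S$ of places, containing the infinite ones, and constants $C_v>0$ $(v\notin S)$ with $\|a_\ell(k)\|_v\le C_v^\ell/\|\ell!\|_v^\alpha$ for all $v\notin S$, all $k$ and all $\ell\ge 0$; (c) $\prod_{v\notin S}C_v<\infty$, that is, the products of the $C_v$ over the finite sets of places outside $S$ are bounded above. *The maps $\gamma_x^i$.* For an integer $x\ge 0$ let $G_x=H^0(\mathcal X;E\otimes H^{\otimes x})$. Contraction with $f=(f_1,\dots,f_s)$ gives an $O_K$-linear map $\langle\cdot;f\rangle:G_x\to\bigoplus_jH^0(\widehat X_{p_j};H_K^{\otimes x})$. Let $\widehat{\mathcal X}^i_{p_j}$ be the $i$-th infinitesimal neighbourhood of $P_j$ in $\mathcal X$ (defined by the $i$-th power of the ideal of $P_j$), and let $G_x^i\subseteq G_x$ be the kernel of the composite of $\langle\cdot;f\rangle$ with the restriction to $\bigoplus_jH^0(\widehat{\mathcal X}^i_{p_j};H^{\otimes x})\otimes K$. Let $T_{p_j}\mathcal X$ be the dual of $P_j^*\Omega^1_{\mathcal X/O_K}$. The exact sequences $$0\to\bigoplus_jH^0(P_j;H^{\otimes x}\otimes (T_{p_j}\mathcal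 X)^{\otimes -i})\to\bigoplus_jH^0(\widehat{\mathcal X}^{i+1}_{p_j};H^{\otimes x})\to\bigoplus_jH^0(\widehat{\mathcal X}^{i}_{p_j};H^{\otimes x})$$ induce an injective $O_K$-linear map $$\gamma_x^i:\ G_x^i/G_x^{i+1}\longrightarrow\Big(\bigoplus_jH^0(P_j;H^{\otimes x}\otimes (T_{p_j}\mathcal X)^{\otimes -i})\Big)\otimes_{O_K} K .$$ For every finite place $v$, with completion $K_v$ and valuation ring $O_v$, let $\|\gamma_x^i\|_v$ be the operator norm of the $K_v$-linear extension of $\gamma_x^i$, both sides being normed by their integral structures: the unit balls are the $O_v$-submodules generated by $G_x^i/G_x^{i+1}$ and by $\bigoplus_jH^0(P_j;H^{\otimes x}\otimes (T_{p_j}\mathcal X)^{\otimes -i})$. **Theorem.** Let $\alpha\ge 0$ and suppose that $f_1,\dots,f_s$ are LG-germs of type $\alpha$. Then there is a real constant $C$ such that, for all integers $i,x\ge 0$ which are not both zero and for which $\gamma_x^i\ne 0$ (equivalently $G_x^i\neq G_x^{i+1}$), one has $\|\gamma_x^i\|_v>0$ for every finite place $v$, the series $\sum_v\log\|\gamma_x^i\|_v$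 over the finite places converges absolutely, and $$\sum_{v\ \mathrm{finite}}\log\|\gamma_x^i\|_v\ \le\ [K:\mathbb Q]\,\alpha\, i\log i+C(i+x),$$ where $0\log 0=0$. (If $\gamma_x^i=0$, the sum is to be read as $-\infty$.) -/

import Mathlib

open CategoryTheory AlgebraicGeometry PowerSeries NumberField IsDedekindDomain
open scoped TensorProduct

universe u

noncomputable section

namespace LGGerms

/-! ### Vector bundles on a scheme and their twists by powers of a line bundle -/

section Bundles

variable {𝒳 : Scheme.{u}}

/-- `e` is a frame (basis of sections) of the sheaf of modules `E` over the open set `U`: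
over every open `V ≤ U` its restriction is a basis of the `Γ(𝒳, V)`-module `Γ(E, V)`. -/
def IsFrame (E : 𝒳.Modules) (U : 𝒳.Opens) {m : ℕ} (e : Fin m → Γ(E, U)) : Prop :=
  ∀ (V : 𝒳.Opens) (hV : V ≤ U), Function.Bijective
    (fun c : Fin m → Γ(𝒳, V) => ∑ k, c k • E.presheaf.map (homOfLE hV).op (e k))

/-- `E` is a vector bundle of rank `m`: a sheaf of modules that has a frame of length `m` in a
neighbourhood of every point. -/
def IsVectorBundle (E : 𝒳.Modules) (m : ℕ) : Prop :=
  ∀ q : 𝒳, ∃ (U : 𝒳.Opens) (_ : q ∈ U) (e : Fin m → Γ(E, U)), IsFrame E U e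

lemma res_res (E : 𝒳.Modules) {U V W : 𝒳.Opens} (hVU : V ≤ U) (hWV : W ≤ V) (t : Γ(E, U)) :
    E.presheaf.map (homOfLE hWV).op (E.presheaf.map (homOfLE hVU).op t) =
      E.presheaf.map (homOfLE (hWV.trans hVU)).op t := by
  rw [← ConcreteCategory.comp_apply, ← Functor.map_comp]
  rfl

lemma res_self (E : 𝒳.Modules) {U : 𝒳.Opens} (t : Γ(E, U)) :
    E.presheaf.map (homOfLE le_rfl).op t = t :=
  congr($(E.presheaf.map_id (.op U)) t)

lemma IsFrame.restrict {E : 𝒳.Modules} {U V : 𝒳.Opens} {m : ℕ} {e : Fin m → Γ(E, U)}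
    (he : IsFrame E U e) (hVU : V ≤ U) :
    IsFrame E V (fun k => E.presheaf.map (homOfLE hVU).op (e k)) := by
  intro W hWV
  simp only [res_res]
  exact he W (hWV.trans hVU)

/-- The generators over `U` of a line bundle `H`. -/
abbrev Generator (H : 𝒳.Modules) (U : 𝒳.Opens) : Type u :=
  {h : Γ(H, U) // IsFrame H U (fun _ : Fin 1 => h)}

lemma Generator.exists_unit {H : 𝒳.Modules} {U : 𝒳.Opens} (h h' : Generator H U) :
    ∃ a : (Γ(𝒳, U))ˣ, h'.1 = (a : Γ(𝒳, U)) • h.1 := by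
  have key (h h' : Generator H U) : ∃ a : Γ(𝒳, U), h'.1 = a • h.1 := by
    obtain ⟨c, hc⟩ := (h.2 U le_rfl).2 h'.1
    refine ⟨c 0, hc.symm.trans ?_⟩
    simp only [res_self, Fin.sum_univ_one, Fin.isValue]
  obtain ⟨a, ha⟩ := key h h'
  obtain ⟨b, hb⟩ := key h' h
  have hab : b * a = 1 := by
    have := (h.2 U le_rfl).1 (a₁ := fun _ => b * a) (a₂ := fun _ => 1) (by
      simp only [res_self, Fin.sum_univ_one, one_smul, mul_smul, ← ha, ← hb])
    exact congrFun this 0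
  exact ⟨⟨a, b, (mul_comm _ _).trans hab, hab⟩, ha⟩

end Bundles

section Model

variable {K : Type u} [Field K] {𝒳 : Scheme.{u}}

/-- The homomorphism `𝓞 K → Γ(𝒳, U)` given by a morphism `π : 𝒳 ⟶ Spec 𝓞 K`. -/
def structHom (π : 𝒳 ⟶ Spec (.of (𝓞 K))) (U : 𝒳.Opens) : 𝓞 K →+* Γ(𝒳, U) :=
  ((Scheme.ΓSpecIso (.of (𝓞 K))).inv ≫ π.appTop ≫
    𝒳.presheaf.map (homOfLE (le_top : U ≤ ⊤)).op).hom

/-- The sections of `E` over `U`, as an `𝓞 K`-module. -/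
def Sec (_ : 𝒳 ⟶ Spec (.of (𝓞 K))) (E : 𝒳.Modules) (U : 𝒳.Opens) : Type u := Γ(E, U)

variable (π : 𝒳 ⟶ Spec (.of (𝓞 K))) (E H : 𝒳.Modules)

instance (U : 𝒳.Opens) : AddCommGroup (Sec π E U) := inferInstanceAs (AddCommGroup Γ(E, U))

instance (U : 𝒳.Opens) : Module Γ(𝒳, U) (Sec π E U) := inferInstanceAs (Module Γ(𝒳, U) Γ(E, U))

instance (U : 𝒳.Opens) : Module (𝓞 K) (Sec π E U) := Module.compHom (Sec π E U) (structHom π U)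

/-- Restriction of sections. -/
def Sec.res {U V : 𝒳.Opens} (hVU : V ≤ U) (t : Sec π E U) : Sec π E V :=
  E.presheaf.map (homOfLE hVU).op t

lemma Sec.smul_def {U : 𝒳.Opens} (c : 𝓞 K) (t : Sec π E U) : c • t = structHom π U c • t := rfl

lemma res_structHom {U V : 𝒳.Opens} (hVU : V ≤ U) (c : 𝓞 K) :
    𝒳.presheaf.map (homOfLE hVU).op (structHom π U c) = structHom π V c := by
  simp only [structHom]
  rw [← CommRingCat.comp_apply]
  simp only [Category.assoc, ← Functor.map_comp]
  rfl

lemma Sec.res_add {U V : 𝒳.Opens} (hVU : V ≤ U) (s t : Sec π E U) :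
    Sec.res π E hVU (s + t) = Sec.res π E hVU s + Sec.res π E hVU t :=
  map_add (E.presheaf.map (homOfLE hVU).op).hom s t

lemma Sec.res_zero {U V : 𝒳.Opens} (hVU : V ≤ U) : Sec.res π E hVU 0 = 0 :=
  map_zero (E.presheaf.map (homOfLE hVU).op).hom

lemma Sec.res_smul {U V : 𝒳.Opens} (hVU : V ≤ U) (c : 𝓞 K) (t : Sec π E U) :
    Sec.res π E hVU (c • t) = c • Sec.res π E hVU t := by
  rw [Sec.smul_def, Sec.smul_def, ← res_structHom π hVU c]
  exact E.map_smul (homOfLE hVU) (structHom π U c) t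

/-- The submodule of compatible families that underlies `TwistedSections`. -/
def compatibleFamilies (x : ℕ) :
    Submodule (𝓞 K) (∀ U : 𝒳.Opens, Generator H U → Sec π E U) where
  carrier := {s | ∀ (U V : 𝒳.Opens) (hVU : V ≤ U) (h : Generator H U) (h' : Generator H V)
    (a : (Γ(𝒳, V))ˣ), h'.1 = (a : Γ(𝒳, V)) • H.presheaf.map (homOfLE hVU).op h.1 →
      (a : Γ(𝒳, V)) ^ x • s V h' = Sec.res π E hVU (s U h)}
  add_mem' := by
    intro s t hs ht U V hVU h h' a ha
    rw [Pi.add_apply, Pi.add_apply, Pi.add_apply, Pi.add_apply, smul_add, Sec.res_add,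
      hs U V hVU h h' a ha, ht U V hVU h h' a ha]
  zero_mem' := by
    intro U V hVU h h' a ha
    exact (smul_zero _).trans (Sec.res_zero π E hVU).symm
  smul_mem' := by
    intro c s hs U V hVU h h' a ha
    rw [Pi.smul_apply, Pi.smul_apply, Pi.smul_apply, Pi.smul_apply, Sec.res_smul,
      ← hs U V hVU h h' a ha, Sec.smul_def, Sec.smul_def, smul_smul, smul_smul, mul_comm]

/-- The `𝓞 K`-module `G_x = H⁰(𝒳, E ⊗ H^{⊗ x})` for a line bundle `H`. A section `s` of
`E ⊗ H^{⊗ x}` is given by its values relative to the local generators of `H`: if `h` generates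
`H` over `U` then `s = s(U, h) ⊗ h^{⊗ x}` over `U` for a unique `s(U, h) ∈ Γ(E, U)`, and
`a ^ x · s(V, a · h) = s(U, h)` over `V ≤ U` for every unit `a` on `V`. Conversely, such a
compatible family glues to a section of `E ⊗ H^{⊗ x}`. -/
def TwistedSections (x : ℕ) : Type u := compatibleFamilies π E H x

instance (x : ℕ) : AddCommGroup (TwistedSections π E H x) :=
  inferInstanceAs (AddCommGroup (compatibleFamilies π E H x))

instance (x : ℕ) : Module (𝓞 K) (TwistedSections π E H x) :=
  inferInstanceAs (Module (𝓞 K) (compatibleFamilies π E H x))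

/-- The value `s(U, h)` of a section `s` of `E ⊗ H^{⊗ x}` relative to a generator `h` of `H`. -/
def TwistedSections.val {π : 𝒳 ⟶ Spec (.of (𝓞 K))} {E H : 𝒳.Modules} {x : ℕ}
    (s : TwistedSections π E H x) (U : 𝒳.Opens) (h : Generator H U) : Sec π E U :=
  s.1 U h

lemma TwistedSections.val_add {x : ℕ} (s t : TwistedSections π E H x) (U : 𝒳.Opens)
    (h : Generator H U) : (s + t).val U h = s.val U h + t.val U h := rfl

lemma TwistedSections.val_zero {x : ℕ} (U : 𝒳.Opens) (h : Generator H U) :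
    (0 : TwistedSections π E H x).val U h = 0 := rfl

lemma TwistedSections.val_smul {x : ℕ} (r : 𝓞 K) (s : TwistedSections π E H x) (U : 𝒳.Opens)
    (h : Generator H U) : (r • s).val U h = r • s.val U h := rfl

/-! ### Formal neighbourhoods of sections -/

/-- An isomorphism of `Spf 𝓞 K⟦Z⟧` with the formal completion of `𝒳` along the section `P`.
It is given by a morphism `Spec 𝓞 K⟦Z⟧ ⟶ 𝒳` over `Spec 𝓞 K` that extends `P` (which is the
locus `Z = 0`) and that identifies `Spec (𝓞 K⟦Z⟧ / Z ^ n)`, for every `n`, with the `n`-th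
infinitesimal neighbourhood of `P`, the closed subscheme of `𝒳` defined by the `n`-th power of
the ideal of `P`. -/
structure FormalChart (P : Spec (.of (𝓞 K)) ⟶ 𝒳) where
  /-- The underlying morphism. -/
  map : Spec (.of (𝓞 K)⟦X⟧) ⟶ 𝒳
  map_comp : map ≫ π = Spec.map (CommRingCat.ofHom (C (R := 𝓞 K)))
  extends_section : Spec.map (CommRingCat.ofHom (constantCoeff (R := 𝓞 K))) ≫ map = P
  isClosedImmersion (n : ℕ) : IsClosedImmersion
    (Spec.map (CommRingCat.ofHom (Ideal.Quotient.mk (Ideal.span {(X : (𝓞 K)⟦X⟧) ^ n}))) ≫ map)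
  ker_eq (n : ℕ) :
    (Spec.map (CommRingCat.ofHom
      (Ideal.Quotient.mk (Ideal.span {(X : (𝓞 K)⟦X⟧) ^ n}))) ≫ map).ker = P.ker ^ n

variable {E} in
/-- The function on `φ⁻¹ U` that a morphism `t : E ⟶ φ_* 𝒪_Y` attaches to a section of `E`
over `U`. -/
def functionOf {Y : Scheme.{u}} {φ : Y ⟶ 𝒳}
    (t : E ⟶ (Scheme.Modules.pushforward φ).obj (SheafOfModules.unit Y.ringCatSheaf : Y.Modules))
    (U : 𝒳.Opens) (s : Γ(E, U)) : Γ(Y, φ ⁻¹ᵁ U) :=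
  t.app U s

/-- A trivialization of the pullback of the rank `m` vector bundle `E` along `φ : Y ⟶ 𝒳`:
a morphism `φ^* E ⟶ 𝒪_Y ^ m`, written through its components `E ⟶ φ_* 𝒪_Y`, which is an
isomorphism, that is, which maps frames of `E` to invertible matrices. -/
structure Trivialization {Y : Scheme.{u}} (φ : Y ⟶ 𝒳) (m : ℕ) where
  /-- The components of the trivialization. -/
  coord : Fin m →
    (E ⟶ (Scheme.Modules.pushforward φ).obj (SheafOfModules.unit Y.ringCatSheaf : Y.Modules))
  isUnit_det (U : 𝒳.Opens) (e : Fin m → Γ(E, U)) (he : IsFrame E U e) :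
    IsUnit (Matrix.of (fun k l => functionOf (coord k) U (e l))).det

variable (K) in
/-- The morphism `Spec K⟦Z⟧ ⟶ Spec 𝓞 K⟦Z⟧`; the closed point of `Spec K⟦Z⟧` is mapped to the
generic point of the locus `Z = 0`. -/
def genericMap : Spec (.of K⟦X⟧) ⟶ Spec (.of (𝓞 K)⟦X⟧) :=
  Spec.map (CommRingCat.ofHom (PowerSeries.map (algebraMap (𝓞 K) K)))

variable {π} {P : Spec (.of (𝓞 K)) ⟶ 𝒳}

/-- The `K`-rational point `p_K` of the generic fibre that extends to the section `P`, as a point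
of the topological space of `𝒳`. -/
def FormalChart.point (c : FormalChart π P) : 𝒳 :=
  c.map (genericMap K (IsLocalRing.closedPoint K⟦X⟧))

/-- The power series expansion at `p_K` of a function on the preimage of a neighbourhood of
`p_K`. -/
def FormalChart.expand (c : FormalChart π P) (U : 𝒳.Opens) (hU : c.point ∈ U) :
    Γ(Spec (.of (𝓞 K)⟦X⟧), c.map ⁻¹ᵁ U) →+* K⟦X⟧ :=
  ((Spec (.of (𝓞 K)⟦X⟧)).presheaf.germ (c.map ⁻¹ᵁ U)
      (genericMap K (IsLocalRing.closedPoint K⟦X⟧)) hU ≫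
    Scheme.stalkClosedPointTo (R := .of K⟦X⟧) (genericMap K)).hom

lemma FormalChart.expand_structHom (c : FormalChart π P) (U : 𝒳.Opens) (hU : c.point ∈ U)
    (r : 𝓞 K) : c.expand U hU (c.map.app U (structHom π U r)) = C (algebraMap (𝓞 K) K r) := by
  have h1 : (Spec (.of (𝓞 K)⟦X⟧)).presheaf.map (homOfLE (le_top : c.map ⁻¹ᵁ U ≤ ⊤)).op ≫
      (Spec (.of (𝓞 K)⟦X⟧)).presheaf.germ (c.map ⁻¹ᵁ U)
        (genericMap K (IsLocalRing.closedPoint K⟦X⟧)) hU =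
      (Spec (.of (𝓞 K)⟦X⟧)).presheaf.germ ⊤
        (genericMap K (IsLocalRing.closedPoint K⟦X⟧)) trivial :=
    TopCat.Presheaf.germ_res _ _ _ _
  have h2 : (Spec (.of (𝓞 K)⟦X⟧)).presheaf.germ ⊤
      (genericMap K (IsLocalRing.closedPoint K⟦X⟧)) trivial ≫
        Scheme.stalkClosedPointTo (R := .of K⟦X⟧) (genericMap K) =
      (Scheme.ΓSpecIso (.of (𝓞 K)⟦X⟧)).hom ≫
        CommRingCat.ofHom (PowerSeries.map (algebraMap (𝓞 K) K)) :=
    Scheme.germ_stalkClosedPointTo_Spec _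
  have h3 : 𝒳.presheaf.map (homOfLE (le_top : U ≤ ⊤)).op ≫ c.map.app U = c.map.appTop ≫
      (Spec (.of (𝓞 K)⟦X⟧)).presheaf.map (homOfLE (le_top : c.map ⁻¹ᵁ U ≤ ⊤)).op :=
    c.map.naturality _
  have h4 : (Scheme.ΓSpecIso (.of (𝓞 K))).inv ≫ π.appTop ≫ c.map.appTop =
      CommRingCat.ofHom (C (R := 𝓞 K)) ≫ (Scheme.ΓSpecIso (.of (𝓞 K)⟦X⟧)).inv := by
    rw [Scheme.ΓSpecIso_inv_naturality, ← c.map_comp, Scheme.Hom.comp_appTop]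
  have key : ((Scheme.ΓSpecIso (.of (𝓞 K))).inv ≫ π.appTop ≫
      𝒳.presheaf.map (homOfLE (le_top : U ≤ ⊤)).op) ≫ c.map.app U ≫
      ((Spec (.of (𝓞 K)⟦X⟧)).presheaf.germ (c.map ⁻¹ᵁ U)
        (genericMap K (IsLocalRing.closedPoint K⟦X⟧)) hU ≫
      Scheme.stalkClosedPointTo (R := .of K⟦X⟧) (genericMap K)) =
      CommRingCat.ofHom (C (R := 𝓞 K)) ≫
        CommRingCat.ofHom (PowerSeries.map (algebraMap (𝓞 K) K)) := by
    rw [Category.assoc, Category.assoc, reassoc_of% h3, reassoc_of% h1, h2, reassoc_of% h4,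
      Iso.inv_hom_id_assoc]
  refine (congr($(key).hom r)).trans ?_
  change PowerSeries.map (algebraMap (𝓞 K) K) (C r) = _
  rw [PowerSeries.map_C]

variable {E H}

/-- The `k`-th coordinate, in `K⟦Z⟧`, of a section of `E` over a neighbourhood of `p_K`. -/
def FormalChart.expandSection (c : FormalChart π P) {m : ℕ} (τ : Trivialization E c.map m)
    (k : Fin m) (U : 𝒳.Opens) (hU : c.point ∈ U) (t : Γ(E, U)) : K⟦X⟧ :=
  c.expand U hU (functionOf (τ.coord k) U t)

lemma FormalChart.expandSection_add (c : FormalChart π P) {m : ℕ} (τ : Trivialization E c.map m)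
    (k : Fin m) (U : 𝒳.Opens) (hU : c.point ∈ U) (s t : Sec π E U) :
    c.expandSection τ k U hU (s + t) = c.expandSection τ k U hU s + c.expandSection τ k U hU t :=
  (congrArg (c.expand U hU) (map_add ((τ.coord k).app U).hom s t)).trans
    (map_add (c.expand U hU) _ _)

lemma FormalChart.expandSection_smul' (c : FormalChart π P) {m : ℕ}
    (τ : Trivialization E c.map m) (k : Fin m) (U : 𝒳.Opens) (hU : c.point ∈ U) (g : Γ(𝒳, U))
    (t : Γ(E, U)) : c.expandSection τ k U hU (g • t) =
      c.expand U hU (c.map.app U g) * c.expandSection τ k U hU t :=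
  (congrArg (c.expand U hU) ((τ.coord k).app_smul g t)).trans (map_mul (c.expand U hU) _ _)

lemma FormalChart.expandSection_smul (c : FormalChart π P) {m : ℕ}
    (τ : Trivialization E c.map m) (k : Fin m) (U : 𝒳.Opens) (hU : c.point ∈ U) (r : 𝓞 K)
    (t : Sec π E U) :
    c.expandSection τ k U hU (r • t) =
      C (algebraMap (𝓞 K) K r) * c.expandSection τ k U hU t := by
  rw [Sec.smul_def, ← c.expand_structHom U hU r]
  exact c.expandSection_smul' τ k U hU (structHom π U r) t

lemma FormalChart.expandSection_res (c : FormalChart π P) {m : ℕ}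
    (τ : Trivialization E c.map m) (k : Fin m) {U V : 𝒳.Opens} (hVU : V ≤ U) (hV : c.point ∈ V)
    (t : Γ(E, U)) : c.expandSection τ k V hV (E.presheaf.map (homOfLE hVU).op t) =
      c.expandSection τ k U (hVU hV) t := by
  have h1 : functionOf (τ.coord k) V (E.presheaf.map (homOfLE hVU).op t) =
      (Spec (.of (𝓞 K)⟦X⟧)).presheaf.map (homOfLE fun _ h => hVU h :
        c.map ⁻¹ᵁ V ⟶ c.map ⁻¹ᵁ U).op (functionOf (τ.coord k) U t) :=
    congr($((τ.coord k).mapPresheaf.naturality (homOfLE hVU).op) t)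
  have h2 := TopCat.Presheaf.germ_res (Spec (.of (𝓞 K)⟦X⟧)).presheaf
    (homOfLE fun _ h => hVU h : c.map ⁻¹ᵁ V ⟶ c.map ⁻¹ᵁ U)
    (genericMap K (IsLocalRing.closedPoint K⟦X⟧)) hV
  rw [expandSection, h1]
  exact congr((Scheme.stalkClosedPointTo (R := .of K⟦X⟧) (genericMap K)).hom
    ($h2 (functionOf (τ.coord k) U t)))

variable (π E H P) in
/-- The isomorphisms that are fixed along a section `P`: a formal coordinate `Z` on `𝒳` along `P`
and trivializations of the restrictions of `E` and `H` to the formal neighbourhood of `P`. -/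
structure FormalFrame (m : ℕ) where
  /-- The formal coordinate. -/
  chart : FormalChart π P
  /-- The trivialization of `E`. -/
  trivE : Trivialization E chart.map m
  /-- The trivialization of `H`. -/
  trivH : Trivialization H chart.map 1

/-- A neighbourhood of `p_K` over which the line bundle `H` has a generator. -/
def FormalChart.nhd (c : FormalChart π P) (hH : IsVectorBundle H 1) : 𝒳.Opens :=
  (hH c.point).choose

lemma FormalChart.point_mem_nhd (c : FormalChart π P) (hH : IsVectorBundle H 1) :
    c.point ∈ c.nhd hH :=
  (hH c.point).choose_spec.choose

/-- A generator of `H` near `p_K`. -/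
def FormalChart.gen (c : FormalChart π P) (hH : IsVectorBundle H 1) :
    Generator H (c.nhd hH) :=
  ⟨(hH c.point).choose_spec.choose_spec.choose 0, by
    have h := (hH c.point).choose_spec.choose_spec.choose_spec
    have h' : (fun _ : Fin 1 => (hH c.point).choose_spec.choose_spec.choose 0) =
        (hH c.point).choose_spec.choose_spec.choose :=
      funext fun k => congrArg _ (Subsingleton.elim 0 k)
    exact h'.symm ▸ h⟩

/-- The map `⟨·; f⟩ : G_x → H⁰(𝒳̂_p; H^{⊗ x}) ⊗ K = K⟦Z⟧` for a formal germ
`f = (f_1, …, f_m) ∈ K⟦Z⟧ ^ m` of section of the dual of `E` at `p_K`. The section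
`s(U, h) ⊗ h^{⊗ x}` is mapped to `(∑ k, s(U, h)_k * f_k) * h ^ x`, where `s(U, h)_k` and `h` are
expanded in the fixed trivializations; this does not depend on the neighbourhood `U` of `p_K` nor
on the generator `h` of `H` over `U`, see `pairing_eq`. -/
def pairing {m : ℕ} (F : FormalFrame π E H P m) (hH : IsVectorBundle H 1) (f : Fin m → K⟦X⟧)
    (x : ℕ) : TwistedSections π E H x →+ K⟦X⟧ where
  toFun s := (∑ k, F.chart.expandSection F.trivE k (F.chart.nhd hH) (F.chart.point_mem_nhd hH)
      (s.val (F.chart.nhd hH) (F.chart.gen hH)) * f k) *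
    F.chart.expandSection F.trivH 0 (F.chart.nhd hH) (F.chart.point_mem_nhd hH)
      (F.chart.gen hH).1 ^ x
  map_zero' := by
    have h (k : Fin m) : F.chart.expandSection F.trivE k (F.chart.nhd hH)
        (F.chart.point_mem_nhd hH) (0 : Sec π E (F.chart.nhd hH)) = 0 := by
      have := F.chart.expandSection_add F.trivE k (F.chart.nhd hH)
        (F.chart.point_mem_nhd hH) 0 0
      rwa [add_zero, left_eq_add] at this
    refine mul_eq_zero_of_left (Finset.sum_eq_zero fun k _ => mul_eq_zero_of_left (h k) _) _
  map_add' s t := by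
    rw [← add_mul, ← Finset.sum_add_distrib]
    congr 1
    refine Finset.sum_congr rfl fun k _ => ?_
    rw [← add_mul]
    congr 1
    exact F.chart.expandSection_add F.trivE k _ _ _ _

lemma pairing_smul {m : ℕ} (F : FormalFrame π E H P m) (hH : IsVectorBundle H 1)
    (f : Fin m → K⟦X⟧) (x : ℕ) (r : 𝓞 K) (s : TwistedSections π E H x) :
    pairing F hH f x (r • s) = C (algebraMap (𝓞 K) K r) * pairing F hH f x s := by
  have h (k : Fin m) := F.chart.expandSection_smul F.trivE k (F.chart.nhd hH)
    (F.chart.point_mem_nhd hH) r (s.val (F.chart.nhd hH) (F.chart.gen hH))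
  change (∑ k, F.chart.expandSection F.trivE k _ _ (r • s.val _ _) * f k) * _ = _ * (_ * _)
  rw [← mul_assoc, Finset.mul_sum]
  congr 1
  refine Finset.sum_congr rfl fun k _ => ?_
  rw [← mul_assoc]
  congr 1
  exact h k

lemma pairing_eq {m : ℕ} (F : FormalFrame π E H P m) (hH : IsVectorBundle H 1)
    (f : Fin m → K⟦X⟧) (x : ℕ) (s : TwistedSections π E H x) (U : 𝒳.Opens)
    (hU : F.chart.point ∈ U) (h : Generator H U) :
    pairing F hH f x s = (∑ k : Fin m, F.chart.expandSection F.trivE k U hU (s.val U h) * f k) *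
      F.chart.expandSection F.trivH 0 U hU h.1 ^ x := by
  have key (V : 𝒳.Opens) (h₁ h₂ : Generator H V) (hV : F.chart.point ∈ V) :
      (∑ k : Fin m, F.chart.expandSection F.trivE k V hV (s.val V h₁) * f k) *
        F.chart.expandSection F.trivH 0 V hV h₁.1 ^ x =
      (∑ k : Fin m, F.chart.expandSection F.trivE k V hV (s.val V h₂) * f k) *
        F.chart.expandSection F.trivH 0 V hV h₂.1 ^ x := by
    obtain ⟨a, ha⟩ := h₁.exists_unit h₂
    have h3 : (a : Γ(𝒳, V)) ^ x • s.val V h₂ = s.val V h₁ :=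
      (s.2 V V le_rfl h₁ h₂ a (ha.trans (by rw [res_self]))).trans (res_self E _)
    have h4 (k : Fin m) := F.chart.expandSection_smul' F.trivE k V hV
      ((a : Γ(𝒳, V)) ^ x) (s.val V h₂)
    have h5 := F.chart.expandSection_smul' F.trivH 0 V hV (a : Γ(𝒳, V)) h₁.1
    have alg (A B : Fin m → K⟦X⟧) (b c d : K⟦X⟧) (hA : ∀ k, A k = b ^ x * B k) (hd : d = b * c) :
        (∑ k, A k * f k) * c ^ x = (∑ k, B k * f k) * d ^ x := by
      rw [hd, mul_pow, ← mul_assoc, Finset.sum_mul, Finset.sum_mul, Finset.sum_mul]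
      exact Finset.sum_congr rfl fun k _ => by rw [hA k]; ring
    refine alg _ _ _ _ _ (fun k => ?_) ((congrArg _ ha).trans h5)
    exact ((congrArg _ h3.symm).trans (h4 k)).trans
      (congrArg (· * _) (by simp only [map_pow]))
  have key' (U V : 𝒳.Opens) (hVU : V ≤ U) (hV : F.chart.point ∈ V) (h : Generator H U) :
      (∑ k : Fin m, F.chart.expandSection F.trivE k U (hVU hV) (s.val U h) * f k) *
        F.chart.expandSection F.trivH 0 U (hVU hV) h.1 ^ x =
      (∑ k : Fin m, F.chart.expandSection F.trivE k V hV
          (s.val V ⟨H.presheaf.map (homOfLE hVU).op h.1, h.2.restrict hVU⟩) * f k) *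
        F.chart.expandSection F.trivH 0 V hV (H.presheaf.map (homOfLE hVU).op h.1) ^ x := by
    have h3 := s.2 U V hVU h ⟨H.presheaf.map (homOfLE hVU).op h.1, h.2.restrict hVU⟩ 1
      (by rw [Units.val_one, one_smul])
    rw [Units.val_one, one_pow, one_smul] at h3
    rw [F.chart.expandSection_res]
    congr 1
    refine Finset.sum_congr rfl fun k _ => congrArg (· * f k) ?_
    refine ((F.chart.expandSection_res F.trivE k hVU hV (s.val U h)).symm.trans ?_)
    exact congrArg (F.chart.expandSection F.trivE k V hV) h3.symm
  have hV : F.chart.point ∈ F.chart.nhd hH ⊓ U := ⟨F.chart.point_mem_nhd hH, hU⟩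
  exact (key' _ _ inf_le_left hV (F.chart.gen hH)).trans
    ((key _ _ _ hV).trans (key' _ _ inf_le_right hV h).symm)

end Model

/-! ### The filtration of `G_x` and the maps `γ_x^i` -/

section Filtration

variable (K : Type u) [Field K]

/-- The functions on the `n`-th infinitesimal neighbourhood `Spec K⟦Z⟧ / Z ^ n` of `p_K`. In the
fixed trivialization of `H`, they are the sections of `H^{⊗ x}`. -/
def Jet (n : ℕ) : Type u := K⟦X⟧ ⧸ Ideal.span {(X : K⟦X⟧) ^ n}

instance (n : ℕ) : CommRing (Jet K n) :=
  inferInstanceAs (CommRing (K⟦X⟧ ⧸ Ideal.span {(X : K⟦X⟧) ^ n}))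

variable {K} in
/-- The restriction of a formal function to the `n`-th infinitesimal neighbourhood. -/
def Jet.mk (n : ℕ) : K⟦X⟧ →+* Jet K n := Ideal.Quotient.mk (Ideal.span {(X : K⟦X⟧) ^ n})

instance (n : ℕ) : Algebra (𝓞 K) (Jet K n) :=
  ((Jet.mk n).comp ((C (R := K)).comp (algebraMap (𝓞 K) K))).toAlgebra

lemma Jet.smul_mk (n : ℕ) (r : 𝓞 K) (g : K⟦X⟧) :
    r • Jet.mk n g = Jet.mk n (C (algebraMap (𝓞 K) K r) * g) := by
  rw [Algebra.smul_def, map_mul]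
  rfl

/-- The restriction map from the `(i + 1)`-st to the `i`-th infinitesimal neighbourhood. -/
def Jet.restrict (i : ℕ) : Jet K (i + 1) →ₐ[𝓞 K] Jet K i :=
  { Ideal.Quotient.factor (Ideal.span_singleton_le_span_singleton.mpr
      (pow_dvd_pow (X : K⟦X⟧) i.le_succ)) with
    commutes' := fun _ => rfl }

/-- The restriction map from the `(i + 1)`-st to the `i`-th infinitesimal neighbourhoods of the
`s` points. -/
def jetRestrict (s i : ℕ) : (Fin s → Jet K (i + 1)) →ₗ[𝓞 K] (Fin s → Jet K i) :=
  LinearMap.pi fun j => (Jet.restrict K i).toLinearMap ∘ₗ LinearMap.proj j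

/-- The kernel of the restriction map from the `(i + 1)`-st to the `i`-th infinitesimal
neighbourhoods of the points. By the exact sequence
`0 → ⊕ⱼ H⁰(p_j, H^{⊗ x} ⊗ T^{⊗ -i}) ⊗ K → ⊕ⱼ H⁰(X̂^{i+1}_{p_j}; H^{⊗ x}) →
⊕ⱼ H⁰(X̂^i_{p_j}; H^{⊗ x})` it is `⊕ⱼ H⁰(p_j, H^{⊗ x} ⊗ T^{⊗ -i}) ⊗ K`, where `T` is the
tangent line of `𝒳` along `P_j`. -/
abbrev LeadingTerms (s i : ℕ) : Submodule (𝓞 K) (Fin s → Jet K (i + 1)) :=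
  LinearMap.ker (jetRestrict K s i)

/-- The integral structure `⊕ⱼ H⁰(p_j, H^{⊗ x} ⊗ T^{⊗ -i})` of `LeadingTerms`: the leading terms
that are jets along the sections `P_j`, that is, with coefficients in `𝓞 K`. -/
def integralLeadingTerms (s i : ℕ) : Submodule (𝓞 K) (LeadingTerms K s i) where
  carrier := {w | ∀ j, ∃ g : (𝓞 K)⟦X⟧,
    w.1 j = Jet.mk (i + 1) (PowerSeries.map (algebraMap (𝓞 K) K) g)}
  add_mem' := by
    intro w w' hw hw' j
    obtain ⟨g, hg⟩ := hw j
    obtain ⟨g', hg'⟩ := hw' j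
    refine ⟨g + g', ?_⟩
    rw [map_add, map_add, ← hg, ← hg']
    rfl
  zero_mem' := fun j => ⟨0, by rw [map_zero, map_zero]; rfl⟩
  smul_mem' := by
    intro r w hw j
    obtain ⟨g, hg⟩ := hw j
    refine ⟨C r * g, ?_⟩
    rw [map_mul, PowerSeries.map_C, ← Jet.smul_mk, ← hg]
    rfl

variable {K} {𝒳 : Scheme.{u}} {π : 𝒳 ⟶ Spec (.of (𝓞 K))} {E H : 𝒳.Modules} {s m : ℕ}
  {P : Fin s → (Spec (.of (𝓞 K)) ⟶ 𝒳)} (F : ∀ j, FormalFrame π E H (P j) m)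
  (hH : IsVectorBundle H 1) (f : Fin s → Fin m → K⟦X⟧)

/-- The map `⟨·; f⟩_n` from `G_x` to the sections of `H^{⊗ x}` over the `n`-th infinitesimal
neighbourhoods of the points `p_1, …, p_s`. -/
def jetMap (x n : ℕ) : TwistedSections π E H x →ₗ[𝓞 K] (Fin s → Jet K n) where
  toFun t j := Jet.mk n (pairing (F j) hH (f j) x t)
  map_add' t t' := funext fun j => by
    rw [Pi.add_apply, map_add, map_add]
  map_smul' r t := funext fun j => by
    rw [Pi.smul_apply, RingHom.id_apply, pairing_smul, Jet.smul_mk]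

/-- The submodule `G_x^i` of `G_x`, the kernel of `⟨·; f⟩_i`. -/
def fil (x i : ℕ) : Submodule (𝓞 K) (TwistedSections π E H x) :=
  LinearMap.ker (jetMap F hH f x i)

/-- The module `G_x^i / G_x^{i+1}`. -/
abbrev Gr (x i : ℕ) : Type u := fil F hH f x i ⧸ (fil F hH f x (i + 1)).submoduleOf (fil F hH f x i)

lemma jetRestrict_jetMap (x i : ℕ) (t : TwistedSections π E H x) :
    jetRestrict K s i (jetMap F hH f x (i + 1) t) = jetMap F hH f x i t := rfl

/-- The map `γ_x^i : G_x^i / G_x^{i+1} → ⊕ⱼ H⁰(p_j, H^{⊗ x} ⊗ T^{⊗ -i}) ⊗ K` induced by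
`⟨·; f⟩_{i+1}`. -/
def gamma (x i : ℕ) : Gr F hH f x i →ₗ[𝓞 K] LeadingTerms K s i :=
  Submodule.liftQ _
    (LinearMap.codRestrict (LeadingTerms K s i)
      (jetMap F hH f x (i + 1) ∘ₗ (fil F hH f x i).subtype)
      (fun t => LinearMap.mem_ker.mpr
        ((jetRestrict_jetMap F hH f x i t.1).trans (LinearMap.mem_ker.mp t.2))))
    (fun _ ht => LinearMap.mem_ker.mpr (Subtype.ext (LinearMap.mem_ker.mp
      (Submodule.mem_comap.mp ht))))

lemma gamma_injective (x i : ℕ) : Function.Injective (gamma F hH f x i) := by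
  rw [← LinearMap.ker_eq_bot, gamma, Submodule.ker_liftQ_eq_bot]
  intro t ht
  exact Submodule.mem_comap.mpr (LinearMap.mem_ker.mpr
    (congrArg Subtype.val (LinearMap.mem_ker.mp ht)))

end Filtration

/-! ### Norms at the finite places -/

section Norms

variable {K : Type u} [Field K] [NumberField K] (v : HeightOneSpectrum (𝓞 K))
  {M N : Type u} [AddCommGroup M] [Module (𝓞 K) M] [AddCommGroup N] [Module (𝓞 K) N]

/-- The `O_v`-submodule `L_{O_v}` of `M_v = K_v ⊗ M` generated by a submodule `L` of `M`. -/
def localLattice (L : Submodule (𝓞 K) M) :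
    Submodule (v.adicCompletionIntegers K) (v.adicCompletion K ⊗[𝓞 K] M) :=
  Submodule.span _ ((fun w : M => (1 : v.adicCompletion K) ⊗ₜ[𝓞 K] w) '' L)

/-- The norm on `M_v = K_v ⊗ M` that is induced by the integral structure `L ⊆ M`, whose unit ball
is `L_{O_v}`. The norm on `K_v` is the normalized one, with `‖a‖ = #(𝓞 K / v) ^ (-v(a))`. -/
def latticeNorm (L : Submodule (𝓞 K) M) (w : v.adicCompletion K ⊗[𝓞 K] M) : ℝ :=
  sInf {r | ∃ a : v.adicCompletion K, r = ‖a‖ ∧ ∃ w₀ ∈ localLattice v L, w = a • w₀}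

/-- The operator norm at `v` of an `𝓞 K`-linear map `g : M → N` for the integral structures
`L ⊆ M` and `L' ⊆ N`. -/
def opNormAt (L : Submodule (𝓞 K) M) (L' : Submodule (𝓞 K) N) (g : M →ₗ[𝓞 K] N) : ℝ :=
  sInf {c | 0 ≤ c ∧ ∀ w : v.adicCompletion K ⊗[𝓞 K] M,
    latticeNorm v L' (g.baseChange (v.adicCompletion K) w) ≤ c * latticeNorm v L w}

end Norms

/-! ### `LG`-germs -/

section Germs

variable {K : Type u} [Field K] [NumberField K]

/-- A power series has positive radius of convergence for the absolute value `w`. -/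
def PositiveRadius (w : K → ℝ) (a : K⟦X⟧) : Prop :=
  ∃ r : ℝ, 0 < r ∧ BddAbove (Set.range fun i : ℕ => w (coeff i a) * r ^ i)

/-- `f ∈ K⟦Z⟧ ^ m` is an `LG`-germ of type `α`. The absolute values at the finite places are the
normalized ones. The finite set of exceptional places may always be enlarged, and it is understood
to contain the infinite places; `S` is the set of finite exceptional places. The last condition
says that the product of the `C_v` over `v ∉ S` is finite. -/
def IsLGGerm (α : ℝ) {m : ℕ} (f : Fin m → K⟦X⟧) : Prop :=
  (∀ k, (∀ v : HeightOneSpectrum (𝓞 K), PositiveRadius (HeightOneSpectrum.adicAbv K v) (f k)) ∧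
    ∀ w : InfinitePlace K, PositiveRadius w (f k)) ∧
  ∃ (S : Finset (HeightOneSpectrum (𝓞 K))) (Cv : HeightOneSpectrum (𝓞 K) → ℝ),
    (∀ v ∉ S, 0 < Cv v ∧ ∀ (k : Fin m) (i : ℕ),
      HeightOneSpectrum.adicAbv K v (coeff i (f k)) ≤
        Cv v ^ i / HeightOneSpectrum.adicAbv K v (i.factorial : K) ^ α) ∧
    BddAbove (Set.range fun T : Finset {v : HeightOneSpectrum (𝓞 K) // v ∉ S} =>
      ∏ v ∈ T, Cv v.1)

end Germs

end LGGerms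

end

/-!
At a finite place `v` with local ring `O ⊆ K`, the formal chart along `P_j` carries `Spec O⟦Z⟧` to
a neighbourhood of the specialization of `p_j` at `v`. If `⟨t; f⟩` is computed with a generator of
`H` over such a neighbourhood, the coefficients of `f_j` get multiplied by power series with
`v`-integral coefficients only. Since `γ_x^i` reads off the coefficients of `Z ^ i`, its norm at `v`
is at most the maximum of the absolute values at `v` of the coefficients of the `f_j` up to degree
`i`. The growth condition of `LG`-germs bounds the logarithm of this maximum by
`β_v (i + 1) - α log ‖i!‖_v` with `∑ v, β_v < ∞`, and `∑ v, -log ‖i!‖_v = [K : ℚ] log i!` by the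
product formula. In the other direction, a nonzero coordinate `c ∈ K` of a value of `γ_x^i` gives
`‖c‖_v ≤ ‖γ_x^i‖_v`, where `‖c‖_v = 1` for almost all `v`; hence positivity and absolute
convergence.
-/

namespace LGGerms

open NumberField.HeightOneSpectrum (adicAbv)

section Integrality

variable {A S : CommRingCat.{u}} [IsLocalRing A] [IsLocalRing S] {Y : Scheme.{u}}

theorem closedPoint_mem_of_eq_specMap_comp {χ : A ⟶ S} {f : Spec A ⟶ Y} {φ : Spec S ⟶ Y}
    (hφ : φ = Spec.map χ ≫ f) {U : Y.Opens} (hU : f (IsLocalRing.closedPoint A) ∈ U) :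
    φ (IsLocalRing.closedPoint S) ∈ U := by
  subst hφ
  exact (Scheme.preimage_eq_top_of_closedPoint_mem f hU).ge (Set.mem_univ (Spec.map χ _))

theorem germ_stalkClosedPointTo_of_eq_specMap_comp {χ : A ⟶ S} {f : Spec A ⟶ Y} {φ : Spec S ⟶ Y}
    (hφ : φ = Spec.map χ ≫ f) {U : Y.Opens} (hU : f (IsLocalRing.closedPoint A) ∈ U)
    (hU' : φ (IsLocalRing.closedPoint S) ∈ U) :
    Y.presheaf.germ U _ hU' ≫ Scheme.stalkClosedPointTo φ =
      Y.presheaf.germ U _ hU ≫ Scheme.stalkClosedPointTo f ≫ χ := by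
  subst hφ
  have h := Scheme.preimage_eq_top_of_closedPoint_mem f hU
  have h_nat := (Spec.map χ).naturality (eqToHom h.symm).op
  rw [Scheme.germ_stalkClosedPointTo, Scheme.germ_stalkClosedPointTo_assoc, Iso.trans_hom,
    Iso.trans_hom, Category.assoc, ← Scheme.ΓSpecIso_naturality, Scheme.Hom.comp_app]
  exact (Category.assoc _ _ _).trans congr(f.app U ≫ $h_nat.symm ≫ (Scheme.ΓSpecIso S).hom)

variable {K : Type u} [Field K] [NumberField K] (v : HeightOneSpectrum (𝓞 K))

/-- The localization map `Spec O⟦Z⟧ ⟶ Spec (𝓞 K)⟦Z⟧`, where `O ⊆ K` is the local ring of `𝓞 K`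
at `v`. -/
noncomputable def localRingMap :
    Spec (.of (v.valuationSubringAtPrime K)⟦X⟧) ⟶ Spec (.of (𝓞 K)⟦X⟧) :=
  Spec.map (CommRingCat.ofHom (PowerSeries.map (algebraMap (𝓞 K) (v.valuationSubringAtPrime K))))

theorem genericMap_eq_comp_localRingMap :
    genericMap K = Spec.map (CommRingCat.ofHom
      (PowerSeries.map (algebraMap (v.valuationSubringAtPrime K) K))) ≫ localRingMap v := by
  rw [genericMap, localRingMap, ← Spec.map_comp, ← CommRingCat.ofHom_comp, ← PowerSeries.map_comp,
    ← IsScalarTower.algebraMap_eq]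

/-- The power series with `v`-integral coefficients, as the image of `O⟦Z⟧`, where `O ⊆ K` is the
local ring of `𝓞 K` at `v`. -/
noncomputable def adicIntegralSeries : Subring K⟦X⟧ :=
  (PowerSeries.map (algebraMap (v.valuationSubringAtPrime K) K)).range

variable {v} in
theorem adicAbv_coeff_le_one {a : K⟦X⟧} (ha : a ∈ adicIntegralSeries v) (n : ℕ) :
    adicAbv K v (coeff n a) ≤ 1 := by
  obtain ⟨b, rfl⟩ := ha
  rw [coeff_map, HeightOneSpectrum.adicAbv_def]
  exact_mod_cast (WithZeroMulInt.toNNReal_le_one_iff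
    (HeightOneSpectrum.one_lt_absNorm_nnreal v)).mpr
      (v.valuationSubringAtPrime_le_valuation (coeff n b).2)

variable {𝒳 : Scheme.{u}} {π : 𝒳 ⟶ Spec (.of (𝓞 K))} {E H : 𝒳.Modules}
  {P : Spec (.of (𝓞 K)) ⟶ 𝒳} {m : ℕ}

/-- The closed point of `Z = 0` over `v`: the specialization at `v` of `p_K`. -/
noncomputable def FormalChart.placePoint (c : FormalChart π P) : 𝒳 :=
  c.map (localRingMap v (IsLocalRing.closedPoint (v.valuationSubringAtPrime K)⟦X⟧))

variable {v}

theorem FormalChart.point_mem_of_placePoint_mem {c : FormalChart π P} {U : 𝒳.Opens}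
    (hU : c.placePoint v ∈ U) : c.point ∈ U :=
  closedPoint_mem_of_eq_specMap_comp (U := c.map ⁻¹ᵁ U) (genericMap_eq_comp_localRingMap v) hU

theorem FormalChart.expand_mem_adicIntegralSeries {c : FormalChart π P} {U : 𝒳.Opens}
    (hU : c.placePoint v ∈ U) (g : Γ(Spec (.of (𝓞 K)⟦X⟧), c.map ⁻¹ᵁ U)) :
    c.expand U (point_mem_of_placePoint_mem hU) g ∈ adicIntegralSeries v := by
  have h := germ_stalkClosedPointTo_of_eq_specMap_comp (U := c.map ⁻¹ᵁ U)
    (genericMap_eq_comp_localRingMap v) hU (point_mem_of_placePoint_mem hU)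
  exact ⟨_, congr($h.symm g)⟩

theorem FormalChart.expandSection_mem_adicIntegralSeries {c : FormalChart π P}
    (τ : Trivialization E c.map m) (k : Fin m) {U : 𝒳.Opens} (hU : c.placePoint v ∈ U)
    (t : Γ(E, U)) :
    c.expandSection τ k U (point_mem_of_placePoint_mem hU) t ∈ adicIntegralSeries v :=
  c.expand_mem_adicIntegralSeries hU _

theorem IsVectorBundle.exists_generator (hH : IsVectorBundle H 1) (q : 𝒳) :
    ∃ U : 𝒳.Opens, q ∈ U ∧ Nonempty (Generator H U) := by
  obtain ⟨U, hU, e, he⟩ := hH q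
  have he₀ : e = fun _ => e 0 := funext fun k => congrArg e (Subsingleton.elim k 0)
  exact ⟨U, hU, e 0, he₀ ▸ he⟩

variable (v) in
theorem adicAbv_sum_le {ι : Type*} (t : Finset ι) {a : ι → K} {B : ℝ} (hB : 0 ≤ B)
    (h : ∀ l ∈ t, adicAbv K v (a l) ≤ B) :
    adicAbv K v (∑ l ∈ t, a l) ≤ B :=
  Finset.sum_induction a (adicAbv K v · ≤ B)
    (fun b c hb hc => (HeightOneSpectrum.adicAbv_add_le_max K v b c).trans (max_le hb hc))
    ((map_zero _).trans_le hB) h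

theorem adicAbv_coeff_mul_le {a b : K⟦X⟧} (ha : a ∈ adicIntegralSeries v) {n : ℕ} {B : ℝ}
    (hB : 0 ≤ B) (hb : ∀ l ≤ n, adicAbv K v (coeff l b) ≤ B) :
    ∀ l ≤ n, adicAbv K v (coeff l (a * b)) ≤ B := by
  intro l hl
  rw [coeff_mul]
  refine adicAbv_sum_le v _ hB fun p hp => ?_
  rw [map_mul]
  exact (mul_le_of_le_one_left (apply_nonneg _ _) (adicAbv_coeff_le_one ha p.1)).trans
    (hb p.2 ((Finset.HasAntidiagonal.antidiagonal.snd_le hp).trans hl))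

theorem adicAbv_coeff_pairing_le (F : FormalFrame π E H P m) (hH : IsVectorBundle H 1)
    {f : Fin m → K⟦X⟧} {n : ℕ} {B : ℝ} (hB : 0 ≤ B)
    (hf : ∀ k, ∀ l ≤ n, adicAbv K v (coeff l (f k)) ≤ B)
    (x : ℕ) (t : TwistedSections π E H x) :
    adicAbv K v (coeff n (pairing F hH f x t)) ≤ B := by
  obtain ⟨U, hU, ⟨h⟩⟩ := hH.exists_generator (F.chart.placePoint v)
  rw [pairing_eq F hH f x t U (FormalChart.point_mem_of_placePoint_mem hU) h, mul_comm]
  refine adicAbv_coeff_mul_le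
    (pow_mem (FormalChart.expandSection_mem_adicIntegralSeries F.trivH 0 hU h.1) x) hB
    (fun l hl => ?_) n le_rfl
  rw [map_sum]
  exact adicAbv_sum_le v _ hB fun k _ => adicAbv_coeff_mul_le
    (FormalChart.expandSection_mem_adicIntegralSeries F.trivE k hU (t.val U h)) hB (hf k) l hl

end Integrality

section LatticeNorm

variable {K : Type u} [Field K] [NumberField K] {v : HeightOneSpectrum (𝓞 K)}
  {M N : Type u} [AddCommGroup M] [Module (𝓞 K) M] [AddCommGroup N] [Module (𝓞 K) N]

theorem mem_adicCompletionIntegers_iff_norm_le_one {a : v.adicCompletion K} :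
    a ∈ v.adicCompletionIntegers K ↔ ‖a‖ ≤ 1 := by
  rw [HeightOneSpectrum.mem_adicCompletionIntegers, FinitePlace.norm_def]
  exact_mod_cast (WithZeroMulInt.toNNReal_le_one_iff
    (HeightOneSpectrum.one_lt_absNorm_nnreal v)).symm

theorem tmul_mem_localLattice {L : Submodule (𝓞 K) M} {y : M} (hy : y ∈ L) :
    (1 : v.adicCompletion K) ⊗ₜ[𝓞 K] y ∈ localLattice v L :=
  Submodule.subset_span ⟨y, hy, rfl⟩

theorem smul_mem_localLattice {L : Submodule (𝓞 K) M} {w : v.adicCompletion K ⊗[𝓞 K] M}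
    (hw : w ∈ localLattice v L) {a : v.adicCompletion K} (ha : ‖a‖ ≤ 1) :
    a • w ∈ localLattice v L := by
  lift a to v.adicCompletionIntegers K using mem_adicCompletionIntegers_iff_norm_le_one.mpr ha
  rw [← Submonoid.smul_def]
  exact (localLattice v L).smul_mem a hw

theorem exists_eq_smul_of_localLattice_top (w : v.adicCompletion K ⊗[𝓞 K] M) :
    ∃ a : v.adicCompletion K, ∃ w₀ ∈ localLattice v (⊤ : Submodule (𝓞 K) M), w = a • w₀ := by
  induction w using TensorProduct.induction_on with
  | zero => exact ⟨0, 0, zero_mem _, (zero_smul _ _).symm⟩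
  | tmul a y =>
    exact ⟨a, 1 ⊗ₜ y, tmul_mem_localLattice trivial, by
      rw [TensorProduct.smul_tmul', smul_eq_mul, mul_one]⟩
  | add w w' hw hw' =>
    obtain ⟨a, w₀, h₀, rfl⟩ := hw
    obtain ⟨b, w₁, h₁, rfl⟩ := hw'
    wlog hab : ‖a‖ ≤ ‖b‖ generalizing a b w₀ w₁
    · rw [add_comm]
      exact this b w₁ h₁ a w₀ h₀ (le_of_not_ge hab)
    have ha : a = b * (a / b) := by
      rcases eq_or_ne b 0 with rfl | hb
      · simpa using hab
      · rw [mul_div_cancel₀ _ hb]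
    have hdiv : ‖a / b‖ ≤ 1 := (norm_div a b).trans_le (div_le_one_of_le₀ hab (norm_nonneg b))
    exact ⟨b, (a / b) • w₀ + w₁, add_mem (smul_mem_localLattice h₀ hdiv) h₁, by
      rw [smul_add, smul_smul, ← ha]⟩

theorem latticeNorm_le {L : Submodule (𝓞 K) M} {w₀ : v.adicCompletion K ⊗[𝓞 K] M}
    (hw₀ : w₀ ∈ localLattice v L) (a : v.adicCompletion K) : latticeNorm v L (a • w₀) ≤ ‖a‖ :=
  csInf_le ⟨0, by rintro _ ⟨a, rfl, -⟩; exact norm_nonneg a⟩ ⟨a, rfl, w₀, hw₀, rfl⟩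

section LinearMap

variable {W : Type*} [NormedAddCommGroup W] [NormedSpace (v.adicCompletion K) W]
  [IsUltrametricDist W] {T : v.adicCompletion K ⊗[𝓞 K] M →ₗ[v.adicCompletion K] W}
  {L : Submodule (𝓞 K) M} {B : ℝ} {w : v.adicCompletion K ⊗[𝓞 K] M}

theorem norm_map_le_of_mem_localLattice (hT : ∀ y ∈ L, ‖T (1 ⊗ₜ y)‖ ≤ B)
    (hw : w ∈ localLattice v L) : ‖T w‖ ≤ B := by
  induction hw using Submodule.span_induction with
  | mem w hw =>
    obtain ⟨y, hy, rfl⟩ := hw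
    exact hT y hy
  | zero => simpa using hT 0 (zero_mem L)
  | add w w' _ _ h h' =>
    rw [map_add]
    exact (IsUltrametricDist.norm_add_le_max _ _).trans (max_le h h')
  | smul a w _ h =>
    change ‖T ((a : v.adicCompletion K) • w)‖ ≤ B
    rw [map_smul, norm_smul]
    exact (mul_le_of_le_one_left (norm_nonneg _)
      (mem_adicCompletionIntegers_iff_norm_le_one.mp a.2)).trans h

theorem norm_map_le_mul_latticeNorm (hT : ∀ y ∈ L, ‖T (1 ⊗ₜ y)‖ ≤ B)
    (hw : ∃ a : v.adicCompletion K, ∃ w₀ ∈ localLattice v L, w = a • w₀) :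
    ‖T w‖ ≤ B * latticeNorm v L w := by
  have hB : 0 ≤ B := (norm_nonneg _).trans (hT 0 (zero_mem L))
  obtain ⟨a, w₀, h₀, h⟩ := hw
  rw [latticeNorm, ← smul_eq_mul, ← Real.sInf_smul_of_nonneg hB]
  refine le_csInf ⟨_, ‖a‖, ⟨a, rfl, w₀, h₀, h⟩, rfl⟩ ?_
  rintro _ ⟨_, ⟨b, rfl, w₁, h₁, rfl⟩, rfl⟩
  rw [map_smul, norm_smul, mul_comm]
  exact mul_le_mul_of_nonneg_right (norm_map_le_of_mem_localLattice hT h₁) (norm_nonneg b)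

end LinearMap

section Coordinates

variable {ι : Type*} {L : Submodule (𝓞 K) N} (ψ : N ≃ₗ[𝓞 K] (ι → K))

variable (v) in
/-- The coordinates on `K_v ⊗ N` that extend the coordinates `ψ` on the `K`-vector space `N`. -/
noncomputable def localCoord :
    v.adicCompletion K ⊗[𝓞 K] N →ₗ[v.adicCompletion K] (ι → v.adicCompletion K) :=
  LinearMap.liftBaseChange (v.adicCompletion K)
    (LinearMap.pi fun j =>
      (Algebra.linearMap K (v.adicCompletion K)).restrictScalars (𝓞 K) ∘ₗ
        LinearMap.proj j ∘ₗ ψ.toLinearMap)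

theorem localCoord_tmul (a : v.adicCompletion K) (y : N) (j : ι) :
    localCoord v ψ (a ⊗ₜ y) j = a * algebraMap K (v.adicCompletion K) (ψ y j) := by
  simp [localCoord]

theorem tmul_symm_smul (a : v.adicCompletion K) (c : K) (u : ι → K) :
    a ⊗ₜ[𝓞 K] ψ.symm (c • u) = (a * algebraMap K (v.adicCompletion K) c) ⊗ₜ[𝓞 K] ψ.symm u := by
  have := IsLocalization.linearMap_compatibleSMul (nonZeroDivisors (𝓞 K)) K
    (ι → K) (v.adicCompletion K ⊗[𝓞 K] N)
  have h := LinearMap.CompatibleSMul.map_smul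
    (TensorProduct.mk (𝓞 K) (v.adicCompletion K) N a ∘ₗ ψ.symm.toLinearMap) c u
  rw [mul_comm, ← Algebra.smul_def]
  exact h

variable [Fintype ι]

theorem norm_localCoord_tmul_le_iff {y : N} {B : ℝ} (hB : 0 ≤ B) :
    ‖localCoord v ψ (1 ⊗ₜ y)‖ ≤ B ↔ ∀ j, adicAbv K v (ψ y j) ≤ B := by
  simp only [pi_norm_le_iff_of_nonneg hB, localCoord_tmul, one_mul]
  exact forall_congr' fun j => by rw [← FinitePlace.norm_embedding]; rfl

theorem sum_localCoord_smul [DecidableEq ι] (w : v.adicCompletion K ⊗[𝓞 K] N) :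
    ∑ j, localCoord v ψ w j • (1 ⊗ₜ ψ.symm (Pi.single j 1)) = w := by
  induction w using TensorProduct.induction_on with
  | zero => simp
  | add w w' hw hw' =>
    simp only [map_add, Pi.add_apply, add_smul, Finset.sum_add_distrib, hw, hw']
  | tmul a y =>
    have hy : ∑ j, ψ y j • Pi.single j (1 : K) = ψ y := by
      simp only [← Pi.single_smul, smul_eq_mul, mul_one, Finset.univ_sum_single]
    conv_rhs => rw [← ψ.symm_apply_apply y, ← hy, map_sum, TensorProduct.tmul_sum]
    refine Finset.sum_congr rfl fun j _ => ?_
    rw [tmul_symm_smul, localCoord_tmul, TensorProduct.smul_tmul', smul_eq_mul, mul_one]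

theorem exists_norm_eq_norm_pi {A : Type*} [NormedAddCommGroup A] (u : ι → A) :
    ∃ a : A, ‖a‖ = ‖u‖ := by
  rcases isEmpty_or_nonempty ι with h | h
  · exact ⟨0, by rw [norm_zero, Subsingleton.elim u 0, norm_zero]⟩
  · obtain ⟨j, hj⟩ := Finite.exists_max fun j => ‖u j‖
    exact ⟨u j, (norm_le_pi_norm u j).antisymm ((pi_norm_le_iff_of_nonempty _).mpr hj)⟩

variable {ψ} (hL : ∀ y, y ∈ L ↔ ∀ j, ψ y j ∈ (algebraMap (𝓞 K) K).range)
include hL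

theorem mem_localLattice_iff {w : v.adicCompletion K ⊗[𝓞 K] N} :
    w ∈ localLattice v L ↔ ‖localCoord v ψ w‖ ≤ 1 := by
  classical
  refine ⟨norm_map_le_of_mem_localLattice fun y hy => ?_, fun hw => ?_⟩
  · rw [norm_localCoord_tmul_le_iff ψ zero_le_one]
    intro j
    obtain ⟨r, hr⟩ := (hL y).mp hy j
    exact hr ▸ v.adicAbv_coe_le_one (HeightOneSpectrum.one_lt_absNorm_nnreal v) r
  · rw [← sum_localCoord_smul ψ w]
    refine sum_mem fun j _ => smul_mem_localLattice (tmul_mem_localLattice ((hL _).mpr fun k => ?_))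
      ((norm_le_pi_norm _ j).trans hw)
    rw [ψ.apply_symm_apply, Pi.single_apply]
    split_ifs
    exacts [one_mem _, zero_mem _]

theorem exists_norm_eq_and_eq_smul {w : v.adicCompletion K ⊗[𝓞 K] N} :
    ∃ a : v.adicCompletion K, ‖a‖ = ‖localCoord v ψ w‖ ∧ ∃ w₀ ∈ localLattice v L, w = a • w₀ := by
  classical
  obtain ⟨a, ha⟩ := exists_norm_eq_norm_pi (localCoord v ψ w)
  refine ⟨a, ha, a⁻¹ • w, (mem_localLattice_iff hL).mpr ?_, ?_⟩
  · rw [map_smul, norm_smul, norm_inv, ha]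
    exact inv_mul_le_one
  · rcases eq_or_ne a 0 with rfl | h
    · rw [zero_smul, ← sum_localCoord_smul ψ w, norm_eq_zero.mp (ha.symm.trans norm_zero)]
      simp
    · rw [smul_inv_smul₀ h]

theorem latticeNorm_eq_norm_localCoord (w : v.adicCompletion K ⊗[𝓞 K] N) :
    latticeNorm v L w = ‖localCoord v ψ w‖ := by
  obtain ⟨a, ha, w₀, hw₀, hw⟩ := exists_norm_eq_and_eq_smul hL (w := w)
  apply le_antisymm
  · rw [← ha, hw]
    exact latticeNorm_le hw₀ a
  · rw [← one_mul (latticeNorm v L w)]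
    exact norm_map_le_mul_latticeNorm
      (fun y hy => (mem_localLattice_iff hL).mp (tmul_mem_localLattice hy)) ⟨a, w₀, hw₀, hw⟩

end Coordinates

section OperatorNorm

variable {ι : Type*} [Finite ι] {L : Submodule (𝓞 K) N} {ψ : N ≃ₗ[𝓞 K] (ι → K)}
  (hL : ∀ y, y ∈ L ↔ ∀ j, ψ y j ∈ (algebraMap (𝓞 K) K).range)
  {g : M →ₗ[𝓞 K] N} {B : ℝ} (hB : 0 ≤ B) (hg : ∀ y j, adicAbv K v (ψ (g y) j) ≤ B)

include hL hB hg

theorem latticeNorm_baseChange_le (w : v.adicCompletion K ⊗[𝓞 K] M) :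
    latticeNorm v L (g.baseChange (v.adicCompletion K) w) ≤ B * latticeNorm v ⊤ w := by
  have := Fintype.ofFinite ι
  rw [latticeNorm_eq_norm_localCoord hL]
  exact norm_map_le_mul_latticeNorm (T := localCoord v ψ ∘ₗ g.baseChange (v.adicCompletion K))
    (fun y _ => (norm_localCoord_tmul_le_iff ψ hB).mpr (hg y))
    (exists_eq_smul_of_localLattice_top w)

theorem opNormAt_le : opNormAt v ⊤ L g ≤ B :=
  csInf_le ⟨0, fun _ hc => hc.1⟩ ⟨hB, latticeNorm_baseChange_le hL hB hg⟩

theorem le_opNormAt (y : M) (j : ι) : adicAbv K v (ψ (g y) j) ≤ opNormAt v ⊤ L g := by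
  have := Fintype.ofFinite ι
  refine le_csInf ⟨B, hB, latticeNorm_baseChange_le hL hB hg⟩ fun c ⟨hc, h⟩ => ?_
  refine (norm_localCoord_tmul_le_iff ψ hc).mp ?_ j
  calc ‖localCoord v ψ (1 ⊗ₜ g y)‖
      = latticeNorm v L (1 ⊗ₜ g y) := (latticeNorm_eq_norm_localCoord hL _).symm
    _ ≤ c * latticeNorm v ⊤ ((1 : v.adicCompletion K) • 1 ⊗ₜ y) := by
      rw [one_smul]
      exact h (1 ⊗ₜ y)
    _ ≤ c * ‖(1 : v.adicCompletion K)‖ :=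
      mul_le_mul_of_nonneg_left (latticeNorm_le (tmul_mem_localLattice Submodule.mem_top) 1) hc
    _ = c := by rw [norm_one, mul_one]

end OperatorNorm

end LatticeNorm

section LeadingTerms

variable {K : Type u} [Field K]

theorem Jet.mk_surjective (n : ℕ) : Function.Surjective (Jet.mk n : K⟦X⟧ → Jet K n) :=
  Ideal.Quotient.mk_surjective

theorem Jet.mk_eq_mk_iff {n : ℕ} {g h : K⟦X⟧} :
    Jet.mk n g = Jet.mk n h ↔ ∀ l < n, coeff l g = coeff l h := by
  simp only [← sub_eq_zero (b := coeff _ h), ← map_sub, ← X_pow_dvd_iff,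
    ← Ideal.mem_span_singleton]
  exact Ideal.Quotient.eq

/-- The coefficient of `Z ^ i` of a jet on the `(i + 1)`-st infinitesimal neighbourhood. -/
noncomputable def Jet.topCoeff (i : ℕ) : Jet K (i + 1) →ₗ[𝓞 K] K where
  toFun := QuotientAddGroup.lift (Ideal.span {(X : K⟦X⟧) ^ (i + 1)}).toAddSubgroup
    (coeff (R := K) i).toAddMonoidHom fun _ h =>
      X_pow_dvd_iff.mp (Ideal.mem_span_singleton.mp h) i i.lt_succ_self
  map_add' := map_add _
  map_smul' r w := by
    obtain ⟨g, rfl⟩ := Jet.mk_surjective _ w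
    rw [Jet.smul_mk]
    exact (coeff_C_mul _ _ _).trans (Algebra.smul_def _ _).symm

theorem Jet.topCoeff_mk (i : ℕ) (g : K⟦X⟧) : Jet.topCoeff i (Jet.mk (i + 1) g) = coeff i g := rfl

theorem Jet.restrict_eq_zero_iff {i : ℕ} {w : Jet K (i + 1)} :
    Jet.restrict K i w = 0 ↔ w = Jet.mk (i + 1) (C (Jet.topCoeff i w) * X ^ i) := by
  obtain ⟨g, rfl⟩ := Jet.mk_surjective _ w
  change Jet.mk i g = Jet.mk i 0 ↔ _
  rw [Jet.topCoeff_mk, Jet.mk_eq_mk_iff, Jet.mk_eq_mk_iff]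
  refine forall_congr' fun l => ?_
  rw [coeff_C_mul_X_pow, map_zero]
  grind

theorem LeadingTerms.eq_mk {s i : ℕ} (w : LeadingTerms K s i) (j : Fin s) :
    w.1 j = Jet.mk (i + 1) (C (Jet.topCoeff i (w.1 j)) * X ^ i) :=
  Jet.restrict_eq_zero_iff.mp (congrFun (LinearMap.mem_ker.mp w.2) j)

theorem Jet.topCoeff_mk_C_mul_X_pow (i : ℕ) (c : K) :
    Jet.topCoeff i (Jet.mk (i + 1) (C c * X ^ i)) = c := by
  rw [Jet.topCoeff_mk, coeff_C_mul_X_pow, if_pos rfl]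

theorem Jet.restrict_mk_C_mul_X_pow (i : ℕ) (c : K) :
    Jet.restrict K i (Jet.mk (i + 1) (C c * X ^ i)) = 0 := by
  rw [Jet.restrict_eq_zero_iff, Jet.topCoeff_mk_C_mul_X_pow]

/-- The coordinates of leading terms: `(c_j)` corresponds to the jets `c_j Z ^ i`. -/
noncomputable def leadingCoords (s i : ℕ) : LeadingTerms K s i ≃ₗ[𝓞 K] (Fin s → K) where
  toFun w j := Jet.topCoeff i (w.1 j)
  invFun c := ⟨fun j => Jet.mk (i + 1) (C (c j) * X ^ i),
    LinearMap.mem_ker.mpr <| funext fun j => Jet.restrict_mk_C_mul_X_pow i (c j)⟩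
  map_add' w w' := funext fun j => map_add _ (w.1 j) (w'.1 j)
  map_smul' r w := funext fun j => map_smul _ r (w.1 j)
  left_inv w := Subtype.ext <| funext fun j => (LeadingTerms.eq_mk w j).symm
  right_inv c := funext fun j => Jet.topCoeff_mk_C_mul_X_pow i (c j)

theorem mem_integralLeadingTerms_iff {s i : ℕ} {w : LeadingTerms K s i} :
    w ∈ integralLeadingTerms K s i ↔
      ∀ j, leadingCoords s i w j ∈ (algebraMap (𝓞 K) K).range := by
  refine forall_congr' fun j => ⟨?_, ?_⟩
  · rintro ⟨g, hg⟩
    refine ⟨coeff i g, ?_⟩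
    change _ = Jet.topCoeff i (w.1 j)
    rw [hg, Jet.topCoeff_mk, coeff_map]
  · rintro ⟨r, hr⟩
    refine ⟨C r * X ^ i, ?_⟩
    rw [map_mul, map_pow, map_X, map_C, hr]
    exact LeadingTerms.eq_mk w j

end LeadingTerms

section Summability

variable {ι : Type*}

theorem hasSum_log_of_hasFiniteMulSupport {f : ι → ℝ} (hf : f.HasFiniteMulSupport)
    (hf₀ : ∀ i, f i ≠ 0) : HasSum (fun i => Real.log (f i)) (Real.log (∏ᶠ i, f i)) := by
  rw [finprod_eq_prod _ hf, Real.log_prod fun i _ => hf₀ i]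
  refine hasSum_sum_of_ne_finset_zero fun i hi => ?_
  have hi : f i = 1 := Function.notMem_mulSupport.mp (mt (Set.Finite.mem_toFinset hf).mpr hi)
  rw [hi, Real.log_one]

theorem summable_posLog_of_bddAbove_prod {f : ι → ℝ} (hf : ∀ i, 0 < f i)
    (hprod : BddAbove (Set.range fun T : Finset ι => ∏ i ∈ T, f i)) :
    Summable fun i => Real.posLog (f i) := by
  obtain ⟨B, hB⟩ := hprod
  refine summable_of_sum_le (c := Real.log B) (fun i => Real.posLog_nonneg) fun T => ?_
  calc ∑ i ∈ T, Real.posLog (f i) = ∑ i ∈ T with 1 ≤ f i, Real.log (f i) := by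
        rw [Finset.sum_filter]
        refine Finset.sum_congr rfl fun i _ => ?_
        rw [Real.posLog_eq_log_max_one (hf i).le]
        split_ifs with h
        · rw [max_eq_right h]
        · rw [max_eq_left (not_le.mp h).le, Real.log_one]
    _ = Real.log (∏ i ∈ T with 1 ≤ f i, f i) := (Real.log_prod fun i _ => (hf i).ne').symm
    _ ≤ Real.log B := Real.log_le_log (Finset.prod_pos fun i _ => hf i) (hB ⟨_, rfl⟩)

theorem summable_of_le_of_le {f g h : ι → ℝ} (hfg : ∀ i, f i ≤ g i) (hgh : ∀ i, g i ≤ h i)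
    (hf : Summable f) (hh : Summable h) : Summable g := by
  have h_sub : Summable fun i => g i - f i :=
    .of_nonneg_of_le (fun i => sub_nonneg.mpr (hfg i)) (fun i => sub_le_sub_right (hgh i) _)
      (hh.sub hf)
  simpa only [sub_add_cancel] using h_sub.add hf

end Summability

section FinitePlaces

variable {K : Type u} [Field K] [NumberField K]

theorem hasFiniteMulSupport_adicAbv {a : K} (ha : a ≠ 0) :
    (fun v : HeightOneSpectrum (𝓞 K) => adicAbv K v a).HasFiniteMulSupport := by
  have h := (FinitePlace.hasFiniteMulSupport ha).fun_comp_of_injective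
    FinitePlace.equivHeightOneSpectrum.symm.injective
  simpa only [FinitePlace.equivHeightOneSpectrum_symm_apply, FinitePlace.norm_embedding] using h

theorem hasSum_log_adicAbv {a : K} (ha : a ≠ 0) :
    HasSum (fun v : HeightOneSpectrum (𝓞 K) => Real.log (adicAbv K v a))
      (-Real.log |(Algebra.norm ℚ a : ℝ)|) := by
  have h := hasSum_log_of_hasFiniteMulSupport (hasFiniteMulSupport_adicAbv ha)
    fun v => (adicAbv K v).ne_zero ha
  have h_prod : ∏ᶠ v : HeightOneSpectrum (𝓞 K), adicAbv K v a = |(Algebra.norm ℚ a : ℝ)|⁻¹ := by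
    have h := FinitePlace.prod_eq_inv_abs_norm ha
    rw [← finprod_comp_equiv FinitePlace.equivHeightOneSpectrum.symm] at h
    simpa only [FinitePlace.equivHeightOneSpectrum_symm_apply, FinitePlace.norm_embedding,
      Rat.cast_inv, Rat.cast_abs] using h
  rwa [h_prod, Real.log_inv] at h

variable (K) in
theorem hasSum_log_adicAbv_factorial (n : ℕ) :
    HasSum (fun v : HeightOneSpectrum (𝓞 K) => Real.log (adicAbv K v (n.factorial : K)))
      (-(Module.finrank ℚ K * Real.log n.factorial)) := by
  have h := hasSum_log_adicAbv (K := K) (Nat.cast_ne_zero.mpr n.factorial_ne_zero)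
  have h_norm : Algebra.norm ℚ (n.factorial : K) = n.factorial ^ Module.finrank ℚ K := by
    rw [← map_natCast (algebraMap ℚ K), Algebra.norm_algebraMap]
  rwa [h_norm, Rat.cast_pow, Rat.cast_natCast, abs_pow, Nat.abs_cast, Real.log_pow] at h

theorem hasSum_mul_sub_mul_log_adicAbv_factorial {β : HeightOneSpectrum (𝓞 K) → ℝ}
    (hβ : Summable β) (α : ℝ) (i : ℕ) :
    HasSum (fun v => β v * (i + 1) - α * Real.log (adicAbv K v (i.factorial : K)))
      ((∑' v, β v) * (i + 1) + α * (Module.finrank ℚ K * Real.log i.factorial)) := by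
  have h := (hβ.hasSum.mul_right ((i : ℝ) + 1)).sub
    ((hasSum_log_adicAbv_factorial K i).mul_left α)
  rwa [mul_neg, sub_neg_eq_add] at h

theorem log_factorial_le (n : ℕ) : Real.log n.factorial ≤ n * Real.log n := by
  rw [← Real.log_pow]
  exact Real.log_le_log (Nat.cast_pos.mpr n.factorial_pos) (mod_cast n.factorial_le_pow)

theorem adicAbv_factorial_pos (v : HeightOneSpectrum (𝓞 K)) (n : ℕ) :
    0 < adicAbv K v (n.factorial : K) :=
  (adicAbv K v).pos (Nat.cast_ne_zero.mpr n.factorial_ne_zero)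

theorem adicAbv_factorial_antitone (v : HeightOneSpectrum (𝓞 K)) :
    Antitone fun n : ℕ => adicAbv K v (n.factorial : K) := by
  intro l n h
  obtain ⟨c, hc⟩ := Nat.factorial_dvd_factorial h
  dsimp only
  rw [hc, Nat.cast_mul, map_mul]
  exact mul_le_of_le_one_right (apply_nonneg _ _) (HeightOneSpectrum.adicAbv_natCast_le_one K v c)

end FinitePlaces

section Growth

theorem le_exp_posLog (x : ℝ) : x ≤ Real.exp (Real.posLog x) := by
  rcases le_or_gt x 0 with hx | hx
  · exact hx.trans (Real.exp_pos _).le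
  · exact (Real.log_le_iff_le_exp hx).mp (le_max_right 0 _)

variable {K : Type u} [Field K]

theorem PositiveRadius.exists_le_exp {w : K → ℝ} {a : K⟦X⟧} (h : PositiveRadius w a) :
    ∃ c : ℝ, ∀ l : ℕ, w (coeff l a) ≤ Real.exp (c * (l + 1)) := by
  obtain ⟨r, hr, A, hA⟩ := h
  refine ⟨Real.posLog A + Real.posLog r⁻¹, fun l => ?_⟩
  have hA₀ : 0 ≤ Real.posLog A * l := mul_nonneg Real.posLog_nonneg l.cast_nonneg
  have hr₀ : 0 ≤ Real.posLog r⁻¹ := Real.posLog_nonneg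
  calc w (coeff l a) ≤ A * r⁻¹ ^ l := by
        rw [inv_pow, ← div_eq_mul_inv, le_div_iff₀ (pow_pos hr l)]
        exact hA ⟨l, rfl⟩
    _ ≤ Real.exp (Real.posLog A) * Real.exp (Real.posLog r⁻¹) ^ l := by
        gcongr <;> exact le_exp_posLog _
    _ = Real.exp (Real.posLog A + l * Real.posLog r⁻¹) := by rw [← Real.exp_nat_mul, Real.exp_add]
    _ ≤ Real.exp ((Real.posLog A + Real.posLog r⁻¹) * (l + 1)) :=
        Real.exp_le_exp.mpr (by linarith)

variable [NumberField K] {v : HeightOneSpectrum (𝓞 K)} {α c d : ℝ} {a : K⟦X⟧}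

variable (v α c a) in
/-- The growth condition of `LG`-germs of type `α` at the finite place `v`. The exponent `l + 1`
instead of `l` leaves room for a constant factor, so that the condition holds for some `c` at
every place where `a` has positive radius of convergence. -/
def HasLGGrowthAt : Prop :=
  ∀ l : ℕ, adicAbv K v (coeff l a) ≤ Real.exp (c * (l + 1)) / adicAbv K v (l.factorial : K) ^ α

theorem HasLGGrowthAt.mono (h : HasLGGrowthAt v α c a) (hcd : c ≤ d) : HasLGGrowthAt v α d a :=
  fun l => (h l).trans <| div_le_div_of_nonneg_right
    (Real.exp_le_exp.mpr (mul_le_mul_of_nonneg_right hcd (by positivity)))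
    (Real.rpow_nonneg (apply_nonneg _ _) α)

theorem HasLGGrowthAt.adicAbv_coeff_le (h : HasLGGrowthAt v α c a) (hα : 0 ≤ α) (hc : 0 ≤ c)
    {l n : ℕ} (hl : l ≤ n) : adicAbv K v (coeff l a) ≤
      Real.exp (c * (n + 1) - α * Real.log (adicAbv K v (n.factorial : K))) := by
  have hn := adicAbv_factorial_pos v n
  rw [Real.exp_sub, mul_comm α, ← Real.rpow_def_of_pos hn]
  refine (h l).trans (div_le_div₀ (Real.exp_pos _).le ?_ (Real.rpow_pos_of_pos hn α)
    (Real.rpow_le_rpow hn.le (adicAbv_factorial_antitone v hl) hα))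
  gcongr

theorem PositiveRadius.exists_hasLGGrowthAt (hα : 0 ≤ α) (h : PositiveRadius (adicAbv K v) a) :
    ∃ c, HasLGGrowthAt v α c a := by
  obtain ⟨c, hc⟩ := h.exists_le_exp
  refine ⟨c, fun l => (hc l).trans ?_⟩
  have hl := adicAbv_factorial_pos v l
  exact le_div_self (Real.exp_pos _).le (Real.rpow_pos_of_pos hl α) (Real.rpow_le_one hl.le
    (HeightOneSpectrum.adicAbv_natCast_le_one K v _) hα)

theorem HasLGGrowthAt.of_le_pow {R : ℝ} (hR : 0 ≤ R)
    (h : ∀ l, adicAbv K v (coeff l a) ≤ R ^ l / adicAbv K v (l.factorial : K) ^ α) :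
    HasLGGrowthAt v α (Real.posLog R) a := by
  refine fun l => (h l).trans (div_le_div_of_nonneg_right ?_
    (Real.rpow_nonneg (apply_nonneg _ _) α))
  have hR₀ : 0 ≤ Real.posLog R := Real.posLog_nonneg
  calc R ^ l ≤ Real.exp (Real.posLog R) ^ l := pow_le_pow_left₀ hR (le_exp_posLog R) l
    _ = Real.exp (l * Real.posLog R) := (Real.exp_nat_mul _ l).symm
    _ ≤ Real.exp (Real.posLog R * (l + 1)) := Real.exp_le_exp.mpr (by linarith)

theorem exists_forall_hasLGGrowthAt {ι : Type*} [Finite ι] {a : ι → K⟦X⟧}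
    (h : ∀ k, ∃ c, HasLGGrowthAt v α c (a k)) : ∃ c, ∀ k, HasLGGrowthAt v α c (a k) := by
  choose c hc using h
  obtain ⟨d, hd⟩ := Finite.exists_le c
  exact ⟨d, fun k => (hc k).mono (hd k)⟩

theorem IsLGGerm.exists_summable_hasLGGrowthAt (hα : 0 ≤ α) {m : ℕ} {f : Fin m → K⟦X⟧}
    (hf : IsLGGerm α f) :
    ∃ β : HeightOneSpectrum (𝓞 K) → ℝ, Summable β ∧ ∀ v k, HasLGGrowthAt v α (β v) (f k) := by
  classical
  obtain ⟨hrad, S, R, hR, hprod⟩ := hf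
  choose c hc using fun v => exists_forall_hasLGGrowthAt fun k =>
    ((hrad k).1 v).exists_hasLGGrowthAt hα
  refine ⟨fun v => if v ∈ S then c v else Real.posLog (R v), ?_, fun v k => ?_⟩
  · rw [← S.summable_compl_iff]
    refine (summable_posLog_of_bddAbove_prod (fun v => (hR v.1 v.2).1) hprod).congr fun v => ?_
    exact (if_neg v.2).symm
  · dsimp only
    split_ifs with hv
    · exact hc v k
    · exact .of_le_pow (hR v hv).1.le ((hR v hv).2 k)

theorem exists_summable_hasLGGrowthAt (hα : 0 ≤ α) {m s : ℕ} {f : Fin s → Fin m → K⟦X⟧}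
    (hf : ∀ j, IsLGGerm α (f j)) : ∃ β : HeightOneSpectrum (𝓞 K) → ℝ,
      Summable β ∧ ∀ v j k, HasLGGrowthAt v α (β v) (f j k) := by
  choose β hβ hfβ using fun j => (hf j).exists_summable_hasLGGrowthAt hα
  refine ⟨fun v => ∑ j, |β j v|, summable_sum fun j _ => (hβ j).abs, fun v j k => ?_⟩
  exact (hfβ j v k).mono ((le_abs_self _).trans
    (Finset.single_le_sum (f := fun j => |β j v|) (fun _ _ => abs_nonneg _) (Finset.mem_univ j)))

end Growth

section GlobalNorm

theorem exists_pi_apply_ne_zero {R M N A ι : Type*} [Semiring R] [AddCommMonoid M] [Module R M]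
    [AddCommMonoid N] [Module R N] [AddCommMonoid A] [Module R A] (ψ : N ≃ₗ[R] (ι → A))
    {g : M →ₗ[R] N} (hg : g ≠ 0) : ∃ y j, ψ (g y) j ≠ 0 := by
  by_contra! h
  exact hg (LinearMap.ext fun y => (LinearEquiv.map_eq_zero_iff ψ).mp (funext (h y)))

variable {K : Type u} [Field K] [NumberField K] {M N : Type u} [AddCommGroup M] [Module (𝓞 K) M]
  [AddCommGroup N] [Module (𝓞 K) N] {ι : Type*} [Finite ι] {L : Submodule (𝓞 K) N}
  {ψ : N ≃ₗ[𝓞 K] (ι → K)} (hL : ∀ y, y ∈ L ↔ ∀ j, ψ y j ∈ (algebraMap (𝓞 K) K).range)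
  {g : M →ₗ[𝓞 K] N} {b : HeightOneSpectrum (𝓞 K) → ℝ}
  (hg : ∀ v y j, adicAbv K v (ψ (g y) j) ≤ Real.exp (b v)) (hg₀ : g ≠ 0)

include hL hg hg₀

theorem opNormAt_pos (v : HeightOneSpectrum (𝓞 K)) : 0 < opNormAt v ⊤ L g := by
  obtain ⟨y, j, hc⟩ := exists_pi_apply_ne_zero ψ hg₀
  exact ((adicAbv K v).pos hc).trans_le (le_opNormAt hL (Real.exp_pos _).le (hg v) y j)

theorem log_opNormAt_le (v : HeightOneSpectrum (𝓞 K)) : Real.log (opNormAt v ⊤ L g) ≤ b v :=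
  (Real.log_le_iff_le_exp (opNormAt_pos hL hg hg₀ v)).mpr
    (opNormAt_le hL (Real.exp_pos _).le (hg v))

theorem summable_log_opNormAt (hb : Summable b) :
    Summable fun v => Real.log (opNormAt v ⊤ L g) := by
  obtain ⟨y, j, hc⟩ := exists_pi_apply_ne_zero ψ hg₀
  exact summable_of_le_of_le
    (fun v => Real.log_le_log ((adicAbv K v).pos hc)
      (le_opNormAt hL (Real.exp_pos _).le (hg v) y j))
    (log_opNormAt_le hL hg hg₀) (hasSum_log_adicAbv hc).summable hb

theorem tsum_log_opNormAt_le (hb : Summable b) :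
    ∑' v, Real.log (opNormAt v ⊤ L g) ≤ ∑' v, b v :=
  (summable_log_opNormAt hL hg hg₀ hb).tsum_le_tsum (log_opNormAt_le hL hg hg₀) hb

end GlobalNorm

section Gamma

variable {K : Type u} [Field K] [NumberField K] {𝒳 : Scheme.{u}} {π : 𝒳 ⟶ Spec (.of (𝓞 K))}
  {E H : 𝒳.Modules} {s m : ℕ} {P : Fin s → (Spec (.of (𝓞 K)) ⟶ 𝒳)}
  (F : ∀ j, FormalFrame π E H (P j) m) (hH : IsVectorBundle H 1) {f : Fin s → Fin m → K⟦X⟧}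

theorem adicAbv_leadingCoords_gamma_le {v : HeightOneSpectrum (𝓞 K)} {x i : ℕ} {B : ℝ}
    (hB : 0 ≤ B) (hf : ∀ j k, ∀ l ≤ i, adicAbv K v (coeff l (f j k)) ≤ B) (y : Gr F hH f x i)
    (j : Fin s) : adicAbv K v (leadingCoords s i (gamma F hH f x i y) j) ≤ B := by
  obtain ⟨t, rfl⟩ := Submodule.mkQ_surjective _ y
  exact adicAbv_coeff_pairing_le (F j) hH hB (hf j) x t.1

end Gamma

end LGGerms

theorem mainTheorem8_general {K : Type u} [Field K] [NumberField K]
    {𝒳 : Scheme.{u}} {π : 𝒳 ⟶ Spec (.of (𝓞 K))} {E H : 𝒳.Modules} {m s : ℕ}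
    (hH : LGGerms.IsVectorBundle H 1) {P : Fin s → (Spec (.of (𝓞 K)) ⟶ 𝒳)}
    (F : ∀ j, LGGerms.FormalFrame π E H (P j) m)
    {α : ℝ} (hα : 0 ≤ α) {f : Fin s → Fin m → K⟦X⟧} {β : HeightOneSpectrum (𝓞 K) → ℝ}
    (hβ : Summable β) (hf : ∀ v j k, LGGerms.HasLGGrowthAt v α (β v) (f j k)) :
    ∃ C : ℝ, ∀ x i : ℕ, 1 ≤ i + x → LGGerms.gamma F hH f x i ≠ 0 →
      (∀ v : HeightOneSpectrum (𝓞 K), 0 < LGGerms.opNormAt v ⊤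
        (LGGerms.integralLeadingTerms K s i) (LGGerms.gamma F hH f x i)) ∧
      Summable (fun v : HeightOneSpectrum (𝓞 K) => Real.log (LGGerms.opNormAt v ⊤
        (LGGerms.integralLeadingTerms K s i) (LGGerms.gamma F hH f x i))) ∧
      ∑' v : HeightOneSpectrum (𝓞 K), Real.log (LGGerms.opNormAt v ⊤
        (LGGerms.integralLeadingTerms K s i) (LGGerms.gamma F hH f x i)) ≤
      (Module.finrank ℚ K : ℝ) * α * i * Real.log i + C * ((i : ℝ) + x) := by
  refine ⟨2 * ∑' v, |β v|, fun x i hix hγ => ?_⟩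
  have hL (y) := LGGerms.mem_integralLeadingTerms_iff (K := K) (s := s) (i := i) (w := y)
  have h_coeff (v : HeightOneSpectrum (𝓞 K)) := LGGerms.adicAbv_leadingCoords_gamma_le F hH
    (x := x) (i := i) (Real.exp_pos _).le fun j k l hl =>
      ((hf v j k).mono (le_abs_self _)).adicAbv_coeff_le hα (abs_nonneg _) hl
  have h_sum := LGGerms.hasSum_mul_sub_mul_log_adicAbv_factorial hβ.abs α i
  refine ⟨LGGerms.opNormAt_pos hL h_coeff hγ,
    LGGerms.summable_log_opNormAt hL h_coeff hγ h_sum.summable,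
    (LGGerms.tsum_log_opNormAt_le hL h_coeff hγ h_sum.summable).trans
      (h_sum.tsum_eq.trans_le ?_)⟩
  have hi : (i : ℝ) + 1 ≤ 2 * (i + x) := mod_cast (by lia : i + 1 ≤ 2 * (i + x))
  calc (∑' v, |β v|) * (i + 1) + α * (Module.finrank ℚ K * Real.log i.factorial)
      ≤ (∑' v, |β v|) * (2 * (i + x)) + α * (Module.finrank ℚ K * (i * Real.log i)) := by
        gcongr
        exact LGGerms.log_factorial_le i
    _ = _ := by ring

theorem mainTheorem8 {K : Type u} [Field K] [NumberField K]
    {𝒳 : Scheme.{u}} [AlgebraicGeometry.IsIntegral 𝒳]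
    (π : 𝒳 ⟶ Spec (.of (𝓞 K))) [IsProper π] [Flat π]
    [SmoothOfRelativeDimension 1
      (Limits.pullback.snd π (Spec.map (CommRingCat.ofHom (algebraMap (𝓞 K) K))))]
    (E H : 𝒳.Modules) (m s : ℕ)
    (hE : LGGerms.IsVectorBundle E m) (hH : LGGerms.IsVectorBundle H 1)
    (P : Fin s → (Spec (.of (𝓞 K)) ⟶ 𝒳)) (hP : ∀ j, P j ≫ π = 𝟙 _)
    (hdisj : Pairwise fun j k => Disjoint (Set.range (P j)) (Set.range (P k)))
    (F : ∀ j, LGGerms.FormalFrame π E H (P j) m)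
    (α : ℝ) (hα : 0 ≤ α)
    (f : Fin s → Fin m → K⟦X⟧) (hf : ∀ j, LGGerms.IsLGGerm α (f j)) :
    ∃ C : ℝ, ∀ x i : ℕ, 1 ≤ i + x → LGGerms.gamma F hH f x i ≠ 0 →
      (∀ v : HeightOneSpectrum (𝓞 K), 0 < LGGerms.opNormAt v ⊤
        (LGGerms.integralLeadingTerms K s i) (LGGerms.gamma F hH f x i)) ∧
      Summable (fun v : HeightOneSpectrum (𝓞 K) => Real.log (LGGerms.opNormAt v ⊤
        (LGGerms.integralLeadingTerms K s i) (LGGerms.gamma F hH f x i))) ∧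
      ∑' v : HeightOneSpectrum (𝓞 K), Real.log (LGGerms.opNormAt v ⊤
        (LGGerms.integralLeadingTerms K s i) (LGGerms.gamma F hH f x i)) ≤
      (Module.finrank ℚ K : ℝ) * α * i * Real.log i + C * ((i : ℝ) + x) := by
  obtain ⟨β, hβ, hfβ⟩ := LGGerms.exists_summable_hasLGGrowthAt hα hf
  exact mainTheorem8_general hH F hα hβ hfβ
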